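/- Let $E=\{1,2\}$, $\alpha=4/5$, $f(1)=g(1)=0$, $h(1)=2$, $f(2)=5$, $g(2)=3$, $h(2)=4$ and $\Pi=\begin{pmatrix}1/2&1/2\\0&1\end{pmatrix}$. Let $(X_n)_{n\ge 0}$ be a process on $E$, defined on a measurable space with probability measures $\mathbb P_x$, $x\in E$, such that under each $\mathbb P_x$ it is a Markov chain with transition matrix $\Pi$ and $X_0=x$. Let $(\xi^{(i)}_n)_{n\ge0}$, $i=1,2$, be random variables on the same space which, under each $\mathbb P_x$, are uniformly distributed on $[0,1]$, mutually independent (over all $i$ and $n$), and independent of $X$. Let $\mathcal T_i$ be the set of stopping times (with values in $\{0,1,2,\dots\}\cup\{\infty\}$) with respect to the filtration $\sigma(X_0,\dots,X_n,\xi^{(i)}_0,\dots,\xi^{(i)}_n)$, $n\ge0$. For $\tau_1\in\mathcal T_1$, $\tau_2\in\mathcal T_2$ put \[ J_1(x;\tau_1,\tau_2)=\mathbb E_x\!\left[\alpha^{\tau_1}f(X_{\tau_1})\mathbb I_{\{\tau_1<\tau_2\}}+\alpha^{\tau_2}g(X_{\tau_2})\mathbb I_{\{\tau_2<\tau_1\}}+\alpha^{\tau_1}h(X_{\tau_1})\mathbb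 I_{\{\tau_1=\tau_2<\infty\}}\right],\qquad J_2=-J_1 . \] For a function $p:E\to[0,1]$ let $\tau_i^{p}=\inf\{n\ge0: p(X_n)\ge\xi^{(i)}_n\}$ (with $\inf\emptyset=\infty$). A pair $(p^{(1)},p^{(2)})$ of functions $E\to[0,1]$ is a global Markovian equilibrium if, with $\tilde\tau_i=\tau_i^{p^{(i)}}$, for every $x\in E$ one has $J_1(x;\tilde\tau_1,\tilde\tau_2)=\sup_{\tau_1\in\mathcal T_1}J_1(x;\tau_1,\tilde\tau_2)$ and $J_2(x;\tilde\tau_1,\tilde\tau_2)=\sup_{\tau_2\in\mathcal T_2}J_2(x;\tilde\tau_1,\tau_2)$; it is pure if both functions take only the values $0$ and $1$; its value is $V(x)=J_1(x;\tilde\tau_1,\tilde\tau_2)$. Then: (i) there is no pure global Markovian equilibrium; (ii) the pair given by $p^{(1)}(1)=p^{(2)}(1)=1/2$ and $p^{(1)}(2)=p^{(2)}(2)=1$ is a global Markovian equilibrium, and it is the only one; (iii) its value is $V(1)=1$, $V(2)=4$. -/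

import Mathlib

open MeasureTheory ProbabilityTheory

/-- The probabilistic setting of a two-player Markovian Dynkin game in discrete time, on a countable
discrete state space `E` with transition matrix `Q`: a measurable space `Ω` with probability measures
`P x`, `x : E`, a process `X` which under each `P x` is a homogeneous Markov chain with
transition matrix `Q` started in `x`, and for each player `i : Fin 2` (`0` is player 1 and
`1` is player 2) a sequence `ξ i` of randomization devices. -/
structure DynkinModel (E : Type*) [Countable E] [MeasurableSpace E] [DiscreteMeasurableSpace E]
    (Q : Matrix E E ℝ) (Ω : Type*) [MeasurableSpace Ω] where
  P : E → Measure Ω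
  isProbabilityMeasure_P : ∀ x, IsProbabilityMeasure (P x)
  X : ℕ → Ω → E
  measurable_X : ∀ n, Measurable (X n)
  ξ : Fin 2 → ℕ → Ω → ℝ
  measurable_ξ : ∀ i n, Measurable (ξ i n)
  /-- Under `P x` the chain starts in `x`. -/
  start : ∀ x, ∀ᵐ ω ∂(P x), X 0 ω = x
  /-- The Markov property with one-step transition probabilities `Q`, written without dividing
  by the probability of the past. -/
  markov : ∀ (x : E) (n : ℕ) (y : ℕ → E) (z : E),
    (P x).real {ω | (∀ k ≤ n, X k ω = y k) ∧ X (n + 1) ω = z} =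
      (P x).real {ω | ∀ k ≤ n, X k ω = y k} * Q (y n) z
  /-- Each randomization variable is uniformly distributed on the unit interval. -/
  uniform : ∀ x i n, (P x).map (ξ i n) = volume.restrict (Set.Icc (0 : ℝ) 1)
  /-- The randomization variables of both players at all times are mutually independent. -/
  indep_ξ : ∀ x, iIndepFun (fun (k : Fin 2 × ℕ) (ω : Ω) => ξ k.1 k.2 ω) (P x)
  /-- The randomization variables are independent of the state process. -/
  indep_X_ξ : ∀ x, IndepFun (fun (ω : Ω) (n : ℕ) => X n ω)
    (fun (ω : Ω) (k : Fin 2 × ℕ) => ξ k.1 k.2 ω) (P x)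

namespace DynkinModel

variable {E : Type*} [Countable E] [MeasurableSpace E] [DiscreteMeasurableSpace E]
  {Q : Matrix E E ℝ} {Ω : Type*} [MeasurableSpace Ω]

/-- The information of player `i`: the filtration `σ(X₀, …, Xₙ, ξⁱ₀, …, ξⁱₙ)`. -/
def filtration (M : DynkinModel E Q Ω) (i : Fin 2) : Filtration ℕ ‹MeasurableSpace Ω› where
  seq n := ⨆ k : ℕ, ⨆ _ : k ≤ n,
    (MeasurableSpace.comap (M.X k) inferInstance ⊔ MeasurableSpace.comap (M.ξ i k) inferInstance)
  mono' _ _ hmn := iSup_mono fun _ => iSup_mono' fun hk => ⟨hk.trans hmn, le_rfl⟩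
  le' _ := iSup_le fun k => iSup_le fun _ =>
    sup_le (M.measurable_X k).comap_le (M.measurable_ξ i k).comap_le

/-- The set `𝒯ᵢ` of admissible stopping times of player `i`; the value `⊤` means never stopping. -/
def admissible (M : DynkinModel E Q Ω) (i : Fin 2) : Set (Ω → ℕ∞) :=
  {τ | IsStoppingTime (M.filtration i) τ}

/-- The Markovian randomized stopping time `inf {n | p (Xₙ) ≥ ξⁱₙ}` of player `i` (`inf ∅ = ⊤`)
given by a strategy `p : E → [0,1]`. As `E` is discrete, every such `p` is measurable. -/
noncomputable def markovTime (M : DynkinModel E Q Ω) (i : Fin 2) (p : E → unitInterval) :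
    Ω → ℕ∞ :=
  fun ω => ⨅ n ∈ {n : ℕ | (p (M.X n ω) : ℝ) ≥ M.ξ i n ω}, (n : ℕ∞)

open Classical in
/-- Expected discounted reward, under `P x`, of a player who stops at `τ` while the opponent stops
at `σ`: he receives `f` if he is first, `g` if the opponent is first, `h` if both stop at the
same finite time, and `0` if nobody ever stops. -/
noncomputable def expectedReward (M : DynkinModel E Q Ω) (α : ℝ) (f g h : E → ℝ) (x : E)
    (τ σ : Ω → ℕ∞) : ℝ :=
  ∫ ω, ((if τ ω < σ ω then α ^ (τ ω).toNat * f (M.X (τ ω).toNat ω) else 0)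
      + (if σ ω < τ ω then α ^ (σ ω).toNat * g (M.X (σ ω).toNat ω) else 0)
      + (if τ ω = σ ω ∧ τ ω < ⊤ then α ^ (τ ω).toNat * h (M.X (τ ω).toNat ω) else 0)) ∂(M.P x)

/-- `(τ₁, τ₂)` is a Nash equilibrium for the initial state `x` in the game with payoff functions
`f₁, g₁, h₁` of player 1 and `f₂, g₂, h₂` of player 2. Both players maximize. -/
def IsNashEquilibrium (M : DynkinModel E Q Ω) (α : ℝ) (f₁ g₁ h₁ f₂ g₂ h₂ : E → ℝ) (x : E)
    (τ₁ τ₂ : Ω → ℕ∞) : Prop :=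
  τ₁ ∈ M.admissible 0 ∧ τ₂ ∈ M.admissible 1 ∧
  IsLUB ((fun τ => M.expectedReward α f₁ g₁ h₁ x τ τ₂) '' M.admissible 0)
    (M.expectedReward α f₁ g₁ h₁ x τ₁ τ₂) ∧
  IsLUB ((fun τ => M.expectedReward α f₂ g₂ h₂ x τ τ₁) '' M.admissible 1)
    (M.expectedReward α f₂ g₂ h₂ x τ₂ τ₁)

/-- `(p₁, p₂)` is a global Markovian (randomized) equilibrium of the zero-sum game with payoff
functions `f, g, h`: its stopping times are a Nash equilibrium for every initial state, where the
payoff functions are `f, g, h` for player 1 and `-g, -f, -h` for player 2. -/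
def IsGlobalMarkovEquilibrium (M : DynkinModel E Q Ω) (α : ℝ) (f g h : E → ℝ)
    (p₁ p₂ : E → unitInterval) : Prop :=
  ∀ x, M.IsNashEquilibrium α f g h (-g) (-f) (-h) x (M.markovTime 0 p₁) (M.markovTime 1 p₂)

/-- The value function of the zero-sum game under the strategy pair `(p₁, p₂)`, i.e. the
expected reward of player 1. -/
noncomputable def value (M : DynkinModel E Q Ω) (α : ℝ) (f g h : E → ℝ)
    (p₁ p₂ : E → unitInterval) (x : E) : ℝ :=
  M.expectedReward α f g h x (M.markovTime 0 p₁) (M.markovTime 1 p₂)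

end DynkinModel

/-- A Markovian stopping strategy is pure if it takes only the values `0` and `1`. -/
def IsPureStrategy {E : Type*} (p : E → unitInterval) : Prop := ∀ x, p x = 0 ∨ p x = 1

/-! The data of the example. The states `1, 2` of the game are `0, 1 : Fin 2`. -/

noncomputable def exampleMatrix : Matrix (Fin 2) (Fin 2) ℝ := !![1 / 2, 1 / 2; 0, 1]

noncomputable def exampleDiscount : ℝ := 4 / 5

/-- Reward of player 1 when he stops first. -/
def exampleF : Fin 2 → ℝ := ![0, 5]

/-- Reward of player 1 when player 2 stops first. -/
def exampleG : Fin 2 → ℝ := ![0, 3]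

/-- Reward of player 1 when both players stop simultaneously. -/
def exampleH : Fin 2 → ℝ := ![2, 4]

/-! Against a Markovian strategy `q` the opponent's device at time `n` is independent of the chain
and of every other device. If the opponent is still active, he therefore stops at `n` with
conditional probability `q (X n)`, whatever the player knows (`measure_inter_markovTime_eq`). Each
time step thus becomes a choice between `stopPayoff` and `waitPayoff`. By `stage_identity`, the
reward collected before `n` plus the discounted mean of `v` over the surviving mass moves
monotonically in `n` if `v` dominates both payoffs, and is constant if `v` solves the value
equation. Letting `n` tend to infinity gives `expectedReward_le` and `expectedReward_markovTime`.

The rest is algebra. In the absorbing state stopping at once is forced, and the value is 4. In the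
transient state with value `v` the game is then a 2×2 matrix game: 2 if both stop, 0 if exactly one
stops, and `2 / 5 * (v + 4)` if both wait. For `v = 1` the last entry is 2, so the matrix is twice
the identity, with value 1 and the mixture 1/2 for both players. Uniqueness needs only deviations to
Markovian strategies; optimality among all stopping times comes from `expectedReward_le`. -/

/-- The intersections `A ∩ B` form a π-system that generates `m₁ ⊔ m₂`. -/
theorem MeasureTheory.Measure.eq_of_eq_inter_of_measurableSet_sup {Ω : Type*}
    {m₁ m₂ m₀ : MeasurableSpace Ω} (h₁ : m₁ ≤ m₀) (h₂ : m₂ ≤ m₀) {μ ν : Measure Ω}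
    [IsFiniteMeasure μ]
    (h : ∀ A B, MeasurableSet[m₁] A → MeasurableSet[m₂] B → μ (A ∩ B) = ν (A ∩ B))
    {s : Set Ω} (hs : MeasurableSet[m₁ ⊔ m₂] s) : μ s = ν s := by
  refine ext_on_measurableSpace_of_generate_finite m₀
    {t | ∃ A B, MeasurableSet[m₁] A ∧ MeasurableSet[m₂] B ∧ t = A ∩ B} ?_ (sup_le h₁ h₂) ?_ ?_ ?_ hs
  · rintro _ ⟨A, B, hA, hB, rfl⟩
    exact h A B hA hB
  · refine le_antisymm (sup_le ?_ ?_) (MeasurableSpace.generateFrom_le ?_)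
    · exact fun A hA => MeasurableSpace.measurableSet_generateFrom
        ⟨A, Set.univ, hA, MeasurableSet.univ, (Set.inter_univ A).symm⟩
    · exact fun B hB => MeasurableSpace.measurableSet_generateFrom
        ⟨Set.univ, B, MeasurableSet.univ, hB, (Set.univ_inter B).symm⟩
    · rintro _ ⟨A, B, hA, hB, rfl⟩
      exact MeasurableSet.inter (le_sup_left (b := m₂) A hA) (le_sup_right (a := m₁) B hB)
  · rintro _ ⟨A, B, hA, hB, rfl⟩ _ ⟨A', B', hA', hB', rfl⟩ -
    exact ⟨A ∩ A', B ∩ B', hA.inter hA', hB.inter hB', Set.inter_inter_inter_comm A B A' B'⟩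
  · simpa using h Set.univ Set.univ MeasurableSet.univ MeasurableSet.univ

/-! ### Independence of the devices and the Markov property -/

namespace DynkinModel

variable {E : Type*} [Countable E] [MeasurableSpace E] [DiscreteMeasurableSpace E]
  {Q : Matrix E E ℝ} {Ω : Type*} [MeasurableSpace Ω] (M : DynkinModel E Q Ω)

instance (x : E) : IsProbabilityMeasure (M.P x) := M.isProbabilityMeasure_P x

/-- The σ-algebra generated by the chain up to time `n`. -/
abbrev chainPast (n : ℕ) : MeasurableSpace Ω :=
  ⨆ k : ℕ, ⨆ _ : k ≤ n, MeasurableSpace.comap (M.X k) inferInstance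

/-- The σ-algebra generated by the whole chain. -/
abbrev chainAll : MeasurableSpace Ω :=
  MeasurableSpace.comap (fun (ω : Ω) (n : ℕ) => M.X n ω) inferInstance

/-- The σ-algebra generated by the randomization variables with indices in `S`. -/
abbrev deviceOn (S : Set (Fin 2 × ℕ)) : MeasurableSpace Ω :=
  ⨆ l ∈ S, MeasurableSpace.comap (M.ξ l.1 l.2) inferInstance

theorem chainPast_le_chainAll (n : ℕ) : M.chainPast n ≤ M.chainAll := by
  refine iSup₂_le fun k _ => ?_
  have h : M.X k = (fun y : ℕ → E => y k) ∘ fun (ω : Ω) (n : ℕ) => M.X n ω := rfl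
  rw [h, ← MeasurableSpace.comap_comp]
  exact MeasurableSpace.comap_mono (measurable_pi_apply k).comap_le

theorem chainAll_le : M.chainAll ≤ ‹MeasurableSpace Ω› :=
  (measurable_pi_lambda _ M.measurable_X).comap_le

theorem deviceOn_le (S : Set (Fin 2 × ℕ)) : M.deviceOn S ≤ ‹MeasurableSpace Ω› :=
  iSup₂_le fun l _ => (M.measurable_ξ l.1 l.2).comap_le

theorem deviceOn_mono {S T : Set (Fin 2 × ℕ)} (h : S ⊆ T) : M.deviceOn S ≤ M.deviceOn T :=
  biSup_mono h

theorem indep_chainAll_deviceOn (x : E) (S : Set (Fin 2 × ℕ)) :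
    Indep M.chainAll (M.deviceOn S) (M.P x) := by
  have h := (IndepFun_iff_Indep _ _ _).1 (M.indep_X_ξ x)
  refine indep_of_indep_of_le_right h (iSup₂_le fun k _ => ?_)
  have e : M.ξ k.1 k.2 = (fun y : Fin 2 × ℕ → ℝ => y k) ∘
    fun (ω : Ω) (k : Fin 2 × ℕ) => M.ξ k.1 k.2 ω := rfl
  rw [e, ← MeasurableSpace.comap_comp]
  exact MeasurableSpace.comap_mono (measurable_pi_apply k).comap_le

theorem measurable_X_chainPast {k n : ℕ} (h : k ≤ n) : Measurable[M.chainPast n] (M.X k) :=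
  Measurable.of_comap_le (le_iSup₂_of_le k h le_rfl)

theorem measurable_ξ_deviceOn {S : Set (Fin 2 × ℕ)} {i : Fin 2} {k : ℕ} (h : (i, k) ∈ S) :
    Measurable[M.deviceOn S] (M.ξ i k) :=
  Measurable.of_comap_le (le_iSup₂_of_le (f := fun (l : Fin 2 × ℕ) (_ : l ∈ S) =>
    MeasurableSpace.comap (M.ξ l.1 l.2) inferInstance) (i, k) h le_rfl)

theorem filtration_le_sup {i : Fin 2} {n : ℕ} {S : Set (Fin 2 × ℕ)} (h : ∀ k ≤ n, (i, k) ∈ S) :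
    M.filtration i n ≤ M.chainPast n ⊔ M.deviceOn S :=
  iSup₂_le fun k hk => sup_le_sup (M.measurable_X_chainPast hk).comap_le
    (M.measurable_ξ_deviceOn (h k hk)).comap_le

theorem measure_ξ_le (x : E) (i : Fin 2) (n : ℕ) (c : unitInterval) :
    (M.P x).real {ω | M.ξ i n ω ≤ c} = c := by
  have h : (M.P x).real {ω | M.ξ i n ω ≤ c} = ((M.P x).map (M.ξ i n)).real (Set.Iic (c : ℝ)) := by
    rw [map_measureReal_apply (M.measurable_ξ i n) measurableSet_Iic]; rfl
  rw [h, M.uniform, measureReal_restrict_apply measurableSet_Iic]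
  have : Set.Iic (c : ℝ) ∩ Set.Icc 0 1 = Set.Icc 0 (c : ℝ) := by
    ext t
    simp only [Set.mem_inter_iff, Set.mem_Iic, Set.mem_Icc]
    exact ⟨fun h => ⟨h.2.1, h.1⟩, fun h => ⟨h.2, h.1, h.2.trans c.2.2⟩⟩
  rw [this, Real.volume_real_Icc_of_le c.2.1, sub_zero]

theorem indep_deviceOn (x : E) {S T : Set (Fin 2 × ℕ)} (h : Disjoint S T) :
    Indep (M.deviceOn S) (M.deviceOn T) (M.P x) :=
  indep_iSup_of_disjoint
    (m := fun l : Fin 2 × ℕ => MeasurableSpace.comap (M.ξ l.1 l.2) inferInstance)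
    (fun l => (M.measurable_ξ l.1 l.2).comap_le) (M.indep_ξ x) h

/-- A randomization variable is independent of the chain and of all other ones. -/
theorem measure_inter_ξ_le (x : E) (i : Fin 2) (n : ℕ) (c : unitInterval) {D : Set Ω}
    (hD : MeasurableSet[M.chainAll ⊔ M.deviceOn {(i, n)}ᶜ] D) :
    (M.P x).real (D ∩ {ω | M.ξ i n ω ≤ c}) = c * (M.P x).real D := by
  set C : Set Ω := {ω | M.ξ i n ω ≤ c} with hC
  have hCS : MeasurableSet[M.deviceOn {(i, n)}] C :=
    (M.measurable_ξ_deviceOn (S := {(i, n)}) rfl) measurableSet_Iic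
  have hCm : MeasurableSet C := M.deviceOn_le _ _ hCS
  -- As functions of `D` both sides are measures, so `D = A ∩ B` suffices, with `A` from the chain
  -- and `B` from the other devices. The chain splits off first, then `B` and `C` separate.
  have key : (M.P x).restrict C D = (M.P x C • M.P x) D := by
    refine Measure.eq_of_eq_inter_of_measurableSet_sup M.chainAll_le (M.deviceOn_le _) ?_ hD
    intro A B hA hB
    have hBC := (Indep_iff _ _ _).1 (M.indep_deviceOn x
      (disjoint_compl_left (a := ({(i, n)} : Set (Fin 2 × ℕ))))) B C hB hCS
    have hAB := (Indep_iff _ _ _).1 (M.indep_chainAll_deviceOn x {(i, n)}ᶜ) A B hA hB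
    have hABC := (Indep_iff _ _ _).1 (M.indep_chainAll_deviceOn x Set.univ) A (B ∩ C) hA
      (MeasurableSet.inter (M.deviceOn_mono (Set.subset_univ _) _ hB)
        (M.deviceOn_mono (Set.subset_univ _) _ hCS))
    rw [Measure.restrict_apply' hCm, Measure.smul_apply, Set.inter_assoc, hABC, hBC, hAB,
      smul_eq_mul]
    ring
  rw [Measure.restrict_apply' hCm, Measure.smul_apply, smul_eq_mul] at key
  rw [measureReal_def, key, ENNReal.toReal_mul, ← measureReal_def, ← measureReal_def,
    M.measure_ξ_le]

/-- The field `markov` speaks of single paths. As `E` is finite, `A ∩ {X n = y}` is a finite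
disjoint union of path events ending in `y`, over which it is summed. -/
theorem measure_chainPast_inter_step [Fintype E] (x : E) (n : ℕ) (y z : E) {A : Set Ω}
    (hA : MeasurableSet[M.chainPast n] A) :
    (M.P x).real (A ∩ {ω | M.X n ω = y ∧ M.X (n + 1) ω = z}) =
      Q y z * (M.P x).real (A ∩ {ω | M.X n ω = y}) := by
  classical
  have hle : M.chainPast n ≤
      MeasurableSpace.comap (fun (ω : Ω) (k : Fin (n + 1)) => M.X k ω) inferInstance := by
    refine iSup₂_le fun k hk => ?_
    have h : M.X k = (fun y : Fin (n + 1) → E => y ⟨k, Nat.lt_succ_of_le hk⟩) ∘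
      fun (ω : Ω) (k : Fin (n + 1)) => M.X k ω := rfl
    rw [h, ← MeasurableSpace.comap_comp]
    exact MeasurableSpace.comap_mono (measurable_pi_apply _).comap_le
  obtain ⟨S, -, rfl⟩ := hle A hA
  let T : Finset (Fin (n + 1) → E) := Finset.univ.filter fun s => s ∈ S ∧ s (Fin.last n) = y
  have hX (k : ℕ) (a : E) : MeasurableSet {ω | M.X k ω = a} :=
    M.measurable_X k (measurableSet_singleton a)
  have hs (s : Fin (n + 1) → E) : MeasurableSet {ω | ∀ k : Fin (n + 1), M.X k ω = s k} := by
    rw [Set.ofPred_forall]; exact MeasurableSet.iInter fun k => hX k (s k)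
  have hdis (W : Set Ω) : ((T : Set (Fin (n + 1) → E))).PairwiseDisjoint
      fun s => {ω | ∀ k : Fin (n + 1), M.X k ω = s k} ∩ W := by
    intro s _ t _ hst
    refine Set.disjoint_left.2 fun ω h₁ h₂ => hst (funext fun k => ?_)
    rw [← h₁.1 k, h₂.1 k]
  have hdec (W : Set Ω) : (fun (ω : Ω) (k : Fin (n + 1)) => M.X k ω) ⁻¹' S ∩
      ({ω | M.X n ω = y} ∩ W) = ⋃ s ∈ T, {ω | ∀ k : Fin (n + 1), M.X k ω = s k} ∩ W := by
    ext ω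
    simp only [Set.mem_inter_iff, Set.mem_preimage, Set.mem_ofPred_eq, Set.mem_iUnion, T,
      Finset.mem_filter, Finset.mem_univ, true_and, exists_prop]
    constructor
    · rintro ⟨h₁, h₂, h₃⟩
      exact ⟨_, ⟨h₁, by simpa using h₂⟩, fun _ => rfl, h₃⟩
    · rintro ⟨s, ⟨h₁, h₂⟩, h₃, h₄⟩
      have : (fun k : Fin (n + 1) => M.X k ω) = s := funext h₃
      exact ⟨this ▸ h₁, by rw [← h₂, ← h₃]; simp, h₄⟩
  have e₁ : {ω | M.X n ω = y ∧ M.X (n + 1) ω = z} =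
    {ω | M.X n ω = y} ∩ {ω | M.X (n + 1) ω = z} := rfl
  rw [e₁, hdec, measureReal_biUnion_finset (hdis _) fun s _ => (hs s).inter (hX _ _)]
  have e₂ := hdec Set.univ
  rw [Set.inter_univ] at e₂
  rw [e₂, measureReal_biUnion_finset (hdis _) fun s _ => (hs s).inter MeasurableSet.univ,
    Finset.mul_sum]
  refine Finset.sum_congr rfl fun s hsT => ?_
  -- The path is extended to all of `ℕ`; its values beyond `n` play no role.
  have hmk := M.markov x n (fun k => if h : k < n + 1 then s ⟨k, h⟩ else y) z
  have e₃ : {ω | ∀ k : Fin (n + 1), M.X k ω = s k} =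
      {ω | ∀ k ≤ n, M.X k ω = if h : k < n + 1 then s ⟨k, h⟩ else y} := by
    ext ω
    refine ⟨fun h k hk => ?_, fun h k => ?_⟩
    · rw [dif_pos (Nat.lt_succ_of_le hk)]; exact h ⟨k, _⟩
    · rw [h k (Nat.le_of_lt_succ k.2), dif_pos k.2]
  have hy : (if h : n < n + 1 then s ⟨n, h⟩ else y) = y := by
    rw [dif_pos (Nat.lt_succ_self n)]; exact (Finset.mem_filter.1 hsT).2.2
  simp only [hy] at hmk
  rw [Set.inter_univ, mul_comm, e₃, ← hmk]
  rfl

/-- The Markov property with respect to the chain's past and all randomization variables. -/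
theorem measure_inter_step [Fintype E] (x : E) (n : ℕ) (y z : E) (hQ : 0 ≤ Q y z) {D : Set Ω}
    (hD : MeasurableSet[M.chainPast n ⊔ M.deviceOn Set.univ] D) :
    (M.P x).real (D ∩ {ω | M.X n ω = y ∧ M.X (n + 1) ω = z}) =
      Q y z * (M.P x).real (D ∩ {ω | M.X n ω = y}) := by
  have hX (k : ℕ) (a : E) : MeasurableSet[M.chainAll] {ω | M.X k ω = a} :=
    M.chainPast_le_chainAll k _
      (M.measurable_X_chainPast (le_refl k) (measurableSet_singleton a))
  have hXX : MeasurableSet[M.chainAll] {ω | M.X n ω = y ∧ M.X (n + 1) ω = z} :=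
    MeasurableSet.inter (hX n y) (hX (n + 1) z)
  -- The devices are independent of the whole chain, `X (n + 1)` included, so the device part of `D`
  -- factors out of both sides.
  have key : (M.P x).restrict {ω | M.X n ω = y ∧ M.X (n + 1) ω = z} D =
      (ENNReal.ofReal (Q y z) • (M.P x).restrict {ω | M.X n ω = y}) D := by
    refine Measure.eq_of_eq_inter_of_measurableSet_sup
      ((M.chainPast_le_chainAll n).trans M.chainAll_le) (M.deviceOn_le _) ?_ hD
    intro A B hA hB
    have hA' := M.chainPast_le_chainAll n _ hA
    have hi := (Indep_iff _ _ _).1 (M.indep_chainAll_deviceOn x Set.univ)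
    have hm := M.measure_chainPast_inter_step x n y z hA
    rw [Measure.smul_apply, Measure.restrict_apply' (M.chainAll_le _ hXX),
      Measure.restrict_apply' (M.chainAll_le _ (hX n y)), Set.inter_right_comm A B,
      Set.inter_right_comm A B, hi _ _ (MeasurableSet.inter hA' hXX) hB,
      hi _ _ (MeasurableSet.inter hA' (hX n y)) hB, smul_eq_mul, ← mul_assoc]
    congr 1
    rw [← ofReal_measureReal, hm, ENNReal.ofReal_mul hQ, ofReal_measureReal]
  rw [Measure.smul_apply, Measure.restrict_apply' (M.chainAll_le _ hXX),
      Measure.restrict_apply' (M.chainAll_le _ (hX n y)), smul_eq_mul] at key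
  rw [measureReal_def, key, ENNReal.toReal_mul, ENNReal.toReal_ofReal hQ, ← measureReal_def]

end DynkinModel

/-! ### Markovian stopping times -/

namespace DynkinModel

/-- The σ-algebra on `Ω` is left arbitrary: this serves both for a player's filtration and for the
σ-algebra that omits a single device. -/
theorem measurableSet_forall_lt_device {E Ω : Type*} [MeasurableSpace E]
    [DiscreteMeasurableSpace E] {_ : MeasurableSpace Ω} {X : ℕ → Ω → E}
    {ξ : ℕ → Ω → ℝ} (q : E → unitInterval) {n : ℕ} (hX : ∀ k < n, Measurable (X k))
    (hξ : ∀ k < n, Measurable (ξ k)) :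
    MeasurableSet {ω | ∀ k < n, (q (X k ω) : ℝ) < ξ k ω} := by
  simp only [Set.ofPred_forall]
  refine MeasurableSet.iInter fun k => MeasurableSet.iInter fun hk => ?_
  exact measurableSet_lt ((Measurable.of_discrete (f := fun y => (q y : ℝ))).comp (hX k hk))
    (hξ k hk)

variable {E : Type*} [Countable E] [MeasurableSpace E] [DiscreteMeasurableSpace E]
  {Q : Matrix E E ℝ} {Ω : Type*} [MeasurableSpace Ω] (M : DynkinModel E Q Ω)

theorem le_markovTime_iff (j : Fin 2) (q : E → unitInterval) (n : ℕ) (ω : Ω) :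
    (n : ℕ∞) ≤ M.markovTime j q ω ↔ ∀ k < n, (q (M.X k ω) : ℝ) < M.ξ j k ω := by
  simp only [markovTime, le_iInf_iff, Set.mem_ofPred_eq, Nat.cast_le]
  refine ⟨fun h k hk => ?_, fun h k hk => ?_⟩
  · by_contra hc
    exact absurd (h k (not_lt.1 hc)) (not_le.2 hk)
  · by_contra hc
    exact absurd (h k (not_le.1 hc)) (not_lt.2 hk)

theorem lt_markovTime_iff (j : Fin 2) (q : E → unitInterval) (n : ℕ) (ω : Ω) :
    (n : ℕ∞) < M.markovTime j q ω ↔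
      (n : ℕ∞) ≤ M.markovTime j q ω ∧ (q (M.X n ω) : ℝ) < M.ξ j n ω := by
  rw [← ENat.add_one_le_iff (ENat.natCast_ne_top n)]
  have := M.le_markovTime_iff j q (n + 1) ω
  push_cast at this
  rw [this, le_markovTime_iff]
  simp only [Nat.lt_succ_iff_lt_or_eq, or_imp, forall_and, forall_eq]

theorem markovTime_eq_iff (j : Fin 2) (q : E → unitInterval) (n : ℕ) (ω : Ω) :
    M.markovTime j q ω = n ↔ (n : ℕ∞) ≤ M.markovTime j q ω ∧ M.ξ j n ω ≤ (q (M.X n ω) : ℝ) := by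
  have h := M.lt_markovTime_iff j q n ω
  constructor
  · intro e
    have h₁ : (n : ℕ∞) ≤ M.markovTime j q ω := e.ge
    exact ⟨h₁, not_lt.1 fun hc => (h.2 ⟨h₁, hc⟩).ne' e⟩
  · rintro ⟨h₁, h₂⟩
    exact le_antisymm (not_lt.1 fun hc => not_lt.2 h₂ (h.1 hc).2) h₁

theorem measurable_X_filtration (i : Fin 2) {k n : ℕ} (h : k ≤ n) :
    Measurable[M.filtration i n] (M.X k) :=
  Measurable.of_comap_le (le_iSup₂_of_le k h le_sup_left)

theorem measurable_ξ_filtration (i : Fin 2) {k n : ℕ} (h : k ≤ n) :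
    Measurable[M.filtration i n] (M.ξ i k) :=
  Measurable.of_comap_le (le_iSup₂_of_le k h le_sup_right)

theorem measurableSet_le_markovTime_filtration (i : Fin 2) (p : E → unitInterval) (n : ℕ) :
    MeasurableSet[M.filtration i n] {ω | (n : ℕ∞) ≤ M.markovTime i p ω} := by
  simp only [le_markovTime_iff]
  exact measurableSet_forall_lt_device p (fun _ hk => M.measurable_X_filtration i hk.le)
    fun _ hk => M.measurable_ξ_filtration i hk.le

theorem measurableSet_lt_markovTime_filtration (i : Fin 2) (p : E → unitInterval) (n : ℕ) :
    MeasurableSet[M.filtration i n] {ω | (n : ℕ∞) < M.markovTime i p ω} := by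
  have h : {ω | (n : ℕ∞) < M.markovTime i p ω} =
      {ω | ((n + 1 : ℕ) : ℕ∞) ≤ M.markovTime i p ω} := by
    ext ω
    rw [Set.mem_ofPred_eq, Set.mem_ofPred_eq, Nat.cast_add, Nat.cast_one,
      ENat.add_one_le_iff (ENat.natCast_ne_top n)]
  rw [h]
  simp only [le_markovTime_iff]
  exact measurableSet_forall_lt_device p
    (fun _ hk => M.measurable_X_filtration i (Nat.le_of_lt_succ hk))
    fun _ hk => M.measurable_ξ_filtration i (Nat.le_of_lt_succ hk)

theorem markovTime_mem_admissible (i : Fin 2) (p : E → unitInterval) :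
    M.markovTime i p ∈ M.admissible i := by
  intro n
  have h : {ω | M.markovTime i p ω ≤ (n : ℕ∞)} = {ω | (n : ℕ∞) < M.markovTime i p ω}ᶜ := by
    ext ω; simp
  exact h ▸ (M.measurableSet_lt_markovTime_filtration i p n).compl

/-- Given that player `j` has not stopped before `n`, his Markovian strategy `q` makes him stop at
`n` with probability `q (X n)`, independently of the information of the other player. -/
theorem measure_inter_markovTime_eq (x : E) {i j : Fin 2} (hij : i ≠ j) (q : E → unitInterval)
    (n : ℕ) (y : E) {B : Set Ω} (hB : MeasurableSet[M.filtration i n] B) :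
    (M.P x).real (B ∩ {ω | M.markovTime j q ω = n} ∩ {ω | M.X n ω = y}) =
      q y * (M.P x).real (B ∩ {ω | (n : ℕ∞) ≤ M.markovTime j q ω} ∩ {ω | M.X n ω = y}) := by
  rw [← M.measure_inter_ξ_le x j n (q y)]
  · congr 1
    ext ω
    simp only [Set.mem_inter_iff, Set.mem_ofPred_eq, markovTime_eq_iff]
    constructor
    · rintro ⟨⟨h₁, h₂, h₃⟩, h₄⟩
      exact ⟨⟨⟨h₁, h₂⟩, h₄⟩, h₄ ▸ h₃⟩
    · rintro ⟨⟨⟨h₁, h₂⟩, h₄⟩, h₃⟩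
      exact ⟨⟨h₁, h₂, h₄.symm ▸ h₃⟩, h₄⟩
  -- The remaining event does not involve `ξ j n`: `B` uses devices of `i ≠ j` only, and survival of
  -- `j` up to `n` uses his devices at times before `n`.
  · have hX : ∀ k ≤ n, Measurable[M.chainAll ⊔ M.deviceOn {(j, n)}ᶜ] (M.X k) := fun k hk =>
      (M.measurable_X_chainPast hk).mono ((M.chainPast_le_chainAll n).trans le_sup_left) le_rfl
    refine MeasurableSet.inter (MeasurableSet.inter ?_ ?_)
      (hX n le_rfl (measurableSet_singleton y))
    · refine (M.filtration_le_sup (S := {(j, n)}ᶜ) fun k _ => ?_).trans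
        (sup_le_sup_right (M.chainPast_le_chainAll n) _) _ hB
      simp [hij]
    · simp only [le_markovTime_iff]
      refine measurableSet_forall_lt_device q (fun k hk => hX k hk.le) fun k hk => ?_
      refine (M.measurable_ξ_deviceOn (S := {(j, n)}ᶜ) ?_).mono le_sup_right le_rfl
      simp [hk.ne]

theorem measure_inter_lt_markovTime (x : E) {i j : Fin 2} (hij : i ≠ j) (q : E → unitInterval)
    (n : ℕ) (y : E) {B : Set Ω} (hB : MeasurableSet[M.filtration i n] B) :
    (M.P x).real (B ∩ {ω | (n : ℕ∞) < M.markovTime j q ω} ∩ {ω | M.X n ω = y}) =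
      (1 - q y) *
        (M.P x).real (B ∩ {ω | (n : ℕ∞) ≤ M.markovTime j q ω} ∩ {ω | M.X n ω = y}) := by
  rw [sub_mul, one_mul, ← M.measure_inter_markovTime_eq x hij q n y hB, eq_sub_iff_add_eq,
    ← measureReal_union]
  · congr 1
    ext ω
    simp only [Set.mem_union, Set.mem_inter_iff, Set.mem_ofPred_eq, le_iff_lt_or_eq, eq_comm]
    tauto
  · exact Set.disjoint_left.2 fun ω h₁ h₂ => h₁.1.2.ne' h₂.1.2
  · have hm := M.markovTime_mem_admissible j q
    exact ((M.filtration i).le n _ hB).inter ((M.filtration j).le n _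
      (IsStoppingTime.measurableSet_eq hm n)) |>.inter
      (M.measurable_X n (measurableSet_singleton y))

/-- Both decisions at time `n` depend only on the chain up to `n` and on devices, so the next
transition still follows `Q`. -/
theorem measure_survive_step [Fintype E] (hQ : ∀ y z, 0 ≤ Q y z) (x : E) {i j : Fin 2}
    (hij : i ≠ j) (q : E → unitInterval) (n : ℕ) (y z : E) {B : Set Ω}
    (hB : MeasurableSet[M.filtration i n] B) :
    (M.P x).real (B ∩ {ω | (n : ℕ∞) < M.markovTime j q ω} ∩
        {ω | M.X n ω = y ∧ M.X (n + 1) ω = z}) =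
      Q y z * ((1 - q y) *
        (M.P x).real (B ∩ {ω | (n : ℕ∞) ≤ M.markovTime j q ω} ∩ {ω | M.X n ω = y})) := by
  rw [← M.measure_inter_lt_markovTime x hij q n y hB]
  refine M.measure_inter_step x n y z (hQ y z) (MeasurableSet.inter ?_ ?_)
  · exact M.filtration_le_sup (fun k _ => Set.mem_univ _) _ hB
  · exact M.filtration_le_sup (fun k _ => Set.mem_univ _) _
      (M.measurableSet_lt_markovTime_filtration j q n)

end DynkinModel

/-! ### Decomposition of the reward by time and the verification argument -/

namespace DynkinModel

/-- The expected reward from stopping now while the opponent stops with probability `q`. -/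
def stopPayoff {E : Type*} (f h : E → ℝ) (q : E → unitInterval) (y : E) : ℝ :=
  (1 - q y) * f y + q y * h y

/-- The expected reward from waiting one step while the opponent stops with probability `q`, if
`v` is what the game is worth afterwards. -/
def waitPayoff {E : Type*} [Fintype E] (Q : Matrix E E ℝ) (α : ℝ) (g : E → ℝ)
    (q : E → unitInterval) (v : E → ℝ) (y : E) : ℝ :=
  q y * g y + (1 - q y) * (α * ∑ z, Q y z * v z)

variable {E : Type*} [Countable E] [MeasurableSpace E] [DiscreteMeasurableSpace E]
  {Q : Matrix E E ℝ} {Ω : Type*} [MeasurableSpace Ω] (M : DynkinModel E Q Ω)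

variable {M} in
theorem measurableSet_eq_of_mem_admissible {i : Fin 2} {τ : Ω → ℕ∞} (hτ : τ ∈ M.admissible i)
    (n : ℕ) : MeasurableSet[M.filtration i n] {ω | τ ω = n} :=
  IsStoppingTime.measurableSet_eq hτ n

variable {M} in
theorem measurableSet_gt_of_mem_admissible {i : Fin 2} {τ : Ω → ℕ∞} (hτ : τ ∈ M.admissible i)
    (n : ℕ) : MeasurableSet[M.filtration i n] {ω | (n : ℕ∞) < τ ω} :=
  IsStoppingTime.measurableSet_gt hτ n

variable {M} in
theorem measurableSet_ge_of_mem_admissible {i : Fin 2} {τ : Ω → ℕ∞} (hτ : τ ∈ M.admissible i)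
    (n : ℕ) : MeasurableSet[M.filtration i n] {ω | (n : ℕ∞) ≤ τ ω} :=
  IsStoppingTime.measurableSet_ge hτ n

/-- The undiscounted reward that is paid at time `n`. -/
noncomputable def stageReward (f g h : E → ℝ) (τ σ : Ω → ℕ∞) (n : ℕ) (ω : Ω) : ℝ :=
  ({ω | τ ω = n} ∩ {ω | (n : ℕ∞) < σ ω}).indicator (fun ω => f (M.X n ω)) ω +
  ({ω | (n : ℕ∞) < τ ω} ∩ {ω | σ ω = n}).indicator (fun ω => g (M.X n ω)) ω +
  ({ω | τ ω = n} ∩ {ω | σ ω = n}).indicator (fun ω => h (M.X n ω)) ω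

-- Only the term at the earlier of the two stopping times can be nonzero; if nobody ever stops, all
-- terms vanish.
open Classical in
theorem tsum_stageReward (α : ℝ) (f g h : E → ℝ) (τ σ : Ω → ℕ∞) (ω : Ω) :
    ∑' n : ℕ, α ^ n * M.stageReward f g h τ σ n ω =
      (if τ ω < σ ω then α ^ (τ ω).toNat * f (M.X (τ ω).toNat ω) else 0)
      + (if σ ω < τ ω then α ^ (σ ω).toNat * g (M.X (σ ω).toNat ω) else 0)
      + (if τ ω = σ ω ∧ τ ω < ⊤ then α ^ (τ ω).toNat * h (M.X (τ ω).toNat ω) else 0) := by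
  simp only [stageReward, Set.indicator_apply, Set.mem_inter_iff, Set.mem_ofPred_eq]
  generalize τ ω = t
  generalize σ ω = s
  rcases lt_trichotomy t s with hts | hts | hts
  · lift t to ℕ using hts.ne_top
    rw [tsum_eq_single t]
    · simp [hts, hts.not_gt, hts.ne, hts.ne']
    · intro n hn
      have h₁ : ¬ ((t : ℕ∞) = n) := fun e => hn (by exact_mod_cast e.symm)
      have h₂ : n < t → s ≠ n := fun e => ((Nat.cast_lt.2 e).trans hts).ne'
      simpa [h₁] using fun a b => absurd b (h₂ a)
  · subst hts
    induction t using ENat.recTopCoe with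
    | top => simp
    | coe t =>
      rw [tsum_eq_single t]
      · simp
      · intro n hn
        have h₁ : ¬ ((t : ℕ∞) = n) := fun e => hn (by exact_mod_cast e.symm)
        simp [h₁]
  · lift s to ℕ using hts.ne_top
    rw [tsum_eq_single s]
    · simp [hts, hts.not_gt, hts.ne']
    · intro n hn
      have h₁ : ¬ ((s : ℕ∞) = n) := fun e => hn (by exact_mod_cast e.symm)
      have h₂ : t = n → ¬ n < s := fun e e' => ((Nat.cast_lt.2 e').trans hts).ne' e
      simpa [h₁] using fun a b => absurd b (h₂ a)

/-- The probability that nobody has stopped before time `n` and the chain is then in `y`. -/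
noncomputable def survival (x : E) (τ σ : Ω → ℕ∞) (n : ℕ) (y : E) : ℝ :=
  (M.P x).real ({ω | (n : ℕ∞) ≤ τ ω} ∩ {ω | (n : ℕ∞) ≤ σ ω} ∩ {ω | M.X n ω = y})

/-- The probability that the player stops at `n`, before the opponent acts, in the state `y`. -/
noncomputable def stopping (x : E) (τ σ : Ω → ℕ∞) (n : ℕ) (y : E) : ℝ :=
  (M.P x).real ({ω | τ ω = n} ∩ {ω | (n : ℕ∞) ≤ σ ω} ∩ {ω | M.X n ω = y})

/-- The probability that the player waits at `n`, before the opponent acts, in the state `y`. -/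
noncomputable def waiting (x : E) (τ σ : Ω → ℕ∞) (n : ℕ) (y : E) : ℝ :=
  (M.P x).real ({ω | (n : ℕ∞) < τ ω} ∩ {ω | (n : ℕ∞) ≤ σ ω} ∩ {ω | M.X n ω = y})

theorem stopping_add_waiting {i j : Fin 2} {τ σ : Ω → ℕ∞} (hτ : τ ∈ M.admissible i)
    (hσ : σ ∈ M.admissible j) (x : E) (n : ℕ) (y : E) :
    M.stopping x τ σ n y + M.waiting x τ σ n y = M.survival x τ σ n y := by
  have h₂ := (M.filtration i).le n _ (measurableSet_gt_of_mem_admissible hτ n)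
  have h₄ := (M.filtration j).le n _ (measurableSet_ge_of_mem_admissible hσ n)
  rw [stopping, waiting, survival, ← measureReal_union]
  · congr 1
    ext ω
    simp only [Set.mem_union, Set.mem_inter_iff, Set.mem_ofPred_eq, le_iff_lt_or_eq (b := τ ω),
      eq_comm (a := (n : ℕ∞)) (b := τ ω)]
    tauto
  · exact Set.disjoint_left.2 fun ω h₁ h₂ => h₂.1.1.ne' h₁.1.1
  · exact (h₂.inter h₄).inter (M.measurable_X n (measurableSet_singleton y))

theorem measureReal_X_zero [DecidableEq E] (x y : E) :
    (M.P x).real {ω | M.X 0 ω = y} = if y = x then 1 else 0 := by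
  have h : {ω | M.X 0 ω = y} =ᵐ[M.P x] (if y = x then Set.univ else ∅ : Set Ω) := by
    filter_upwards [M.start x] with ω hω
    apply propext
    change M.X 0 ω = y ↔ ω ∈ (if y = x then Set.univ else ∅ : Set Ω)
    rw [hω]
    split_ifs with hy
    · simp [hy]
    · simp [Ne.symm hy]
  rw [measureReal_congr h]
  split_ifs <;> simp

theorem survival_zero [DecidableEq E] (x : E) (τ σ : Ω → ℕ∞) (y : E) :
    M.survival x τ σ 0 y = if y = x then 1 else 0 := by
  rw [← M.measureReal_X_zero, survival]
  simp

variable [Fintype E]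

theorem integrable_indicator_comp_X (x : E) (n : ℕ) (c : E → ℝ) {A : Set Ω}
    (hA : MeasurableSet A) : Integrable (A.indicator fun ω => c (M.X n ω)) (M.P x) := by
  refine Integrable.indicator (Integrable.of_bound (C := ∑ y, |c y|) ?_ ?_) hA
  · exact (Measurable.of_discrete.comp (M.measurable_X n)).aestronglyMeasurable
  · exact Filter.Eventually.of_forall fun ω =>
      Finset.single_le_sum (f := fun y => |c y|) (fun y _ => abs_nonneg _) (Finset.mem_univ _)

theorem integral_indicator_comp_X (x : E) (n : ℕ) (c : E → ℝ) {A : Set Ω}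
    (hA : MeasurableSet A) :
    ∫ ω, A.indicator (fun ω => c (M.X n ω)) ω ∂(M.P x) =
      ∑ y, (M.P x).real (A ∩ {ω | M.X n ω = y}) * c y := by
  classical
  have hm (y : E) : MeasurableSet (A ∩ {ω | M.X n ω = y}) :=
    hA.inter (M.measurable_X n (measurableSet_singleton y))
  have h : A.indicator (fun ω => c (M.X n ω)) =
      fun ω => ∑ y, (A ∩ {ω | M.X n ω = y}).indicator (fun _ => c y) ω := by
    ext ω
    by_cases hω : ω ∈ A <;> simp [Set.indicator_apply, hω]
  rw [h, integral_finsetSum _ fun y _ => (integrable_const _).indicator (hm y)]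
  exact Finset.sum_congr rfl fun y _ => by rw [integral_indicator_const _ (hm y), smul_eq_mul]

theorem measureReal_eq_sum_inter_X (x : E) (n : ℕ) {A : Set Ω} (hA : MeasurableSet A) :
    (M.P x).real A = ∑ y, (M.P x).real (A ∩ {ω | M.X n ω = y}) := by
  have := M.integral_indicator_comp_X x n (fun _ => 1) hA
  rw [integral_indicator_const _ hA] at this
  simpa using this

theorem abs_stageReward_le (f g h : E → ℝ) (τ σ : Ω → ℕ∞) (n : ℕ) (ω : Ω) :
    |M.stageReward f g h τ σ n ω| ≤ ∑ y, |f y| + ∑ y, |g y| + ∑ y, |h y| := by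
  have key (A : Set Ω) (c : E → ℝ) :
      |A.indicator (fun ω => c (M.X n ω)) ω| ≤ ∑ y, |c y| :=
    (norm_indicator_le_norm_self (fun ω => c (M.X n ω)) ω).trans
      (Finset.single_le_sum (f := fun y => |c y|) (fun y _ => abs_nonneg _) (Finset.mem_univ _))
  exact (abs_add_three _ _ _).trans (add_le_add (add_le_add (key _ f) (key _ g)) (key _ h))

theorem integrable_stageReward {i j : Fin 2} {τ σ : Ω → ℕ∞} (hτ : τ ∈ M.admissible i)
    (hσ : σ ∈ M.admissible j) (f g h : E → ℝ) (x : E) (n : ℕ) :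
    Integrable (M.stageReward f g h τ σ n) (M.P x) := by
  have h₁ := (M.filtration i).le n _ (measurableSet_eq_of_mem_admissible hτ n)
  have h₂ := (M.filtration i).le n _ (measurableSet_gt_of_mem_admissible hτ n)
  have h₃ := (M.filtration j).le n _ (measurableSet_eq_of_mem_admissible hσ n)
  have h₄ := (M.filtration j).le n _ (measurableSet_gt_of_mem_admissible hσ n)
  exact ((M.integrable_indicator_comp_X x n f (h₁.inter h₄)).add
    (M.integrable_indicator_comp_X x n g (h₂.inter h₃))).add
    (M.integrable_indicator_comp_X x n h (h₁.inter h₃))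

theorem hasSum_expectedReward {α : ℝ} (hα₀ : 0 ≤ α) (hα₁ : α < 1) {i j : Fin 2} {τ σ : Ω → ℕ∞}
    (hτ : τ ∈ M.admissible i) (hσ : σ ∈ M.admissible j) (f g h : E → ℝ) (x : E) :
    HasSum (fun n => α ^ n * ∫ ω, M.stageReward f g h τ σ n ω ∂(M.P x))
      (M.expectedReward α f g h x τ σ) := by
  have hint := M.integrable_stageReward hτ hσ f g h x
  have hs : Summable fun n => ∫ ω, ‖α ^ n * M.stageReward f g h τ σ n ω‖ ∂(M.P x) := by
    refine Summable.of_nonneg_of_le (fun n => integral_nonneg fun ω => norm_nonneg _) (fun n => ?_)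
      ((summable_geometric_of_lt_one hα₀ hα₁).mul_right
        (∑ y, |f y| + ∑ y, |g y| + ∑ y, |h y|))
    calc _ ≤ ∫ _, α ^ n * (∑ y, |f y| + ∑ y, |g y| + ∑ y, |h y|) ∂(M.P x) := by
          refine integral_mono ((hint n).const_mul _).norm (integrable_const _) fun ω => ?_
          change ‖_‖ ≤ _
          rw [norm_mul, Real.norm_of_nonneg (pow_nonneg hα₀ n)]
          exact mul_le_mul_of_nonneg_left (M.abs_stageReward_le f g h τ σ n ω)
            (pow_nonneg hα₀ n)
      _ = _ := by simp
  have key := hasSum_integral_of_summable_integral_norm (fun n => (hint n).const_mul (α ^ n)) hs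
  simp only [integral_const_mul, tsum_stageReward] at key
  exact key

theorem integral_stageReward {i j : Fin 2} (hij : i ≠ j) {τ : Ω → ℕ∞} (hτ : τ ∈ M.admissible i)
    (q : E → unitInterval) (f g h : E → ℝ) (x : E) (n : ℕ) :
    ∫ ω, M.stageReward f g h τ (M.markovTime j q) n ω ∂(M.P x) =
      ∑ y, (M.stopping x τ (M.markovTime j q) n y * stopPayoff f h q y +
        M.waiting x τ (M.markovTime j q) n y * (q y * g y)) := by
  have hσ := M.markovTime_mem_admissible j q
  have h₁ := measurableSet_eq_of_mem_admissible hτ n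
  have h₂ := measurableSet_gt_of_mem_admissible hτ n
  have h₁' := (M.filtration i).le n _ h₁
  have h₂' := (M.filtration i).le n _ h₂
  have h₃ := (M.filtration j).le n _ (measurableSet_eq_of_mem_admissible hσ n)
  have h₄ := (M.filtration j).le n _ (measurableSet_gt_of_mem_admissible hσ n)
  have i₁ := M.integrable_indicator_comp_X x n f (h₁'.inter h₄)
  have i₂ := M.integrable_indicator_comp_X x n g (h₂'.inter h₃)
  have i₃ := M.integrable_indicator_comp_X x n h (h₁'.inter h₃)
  have e₀ := (integral_add (i₁.add i₂) i₃).trans (congrArg (· + _) (integral_add i₁ i₂))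
  refine Eq.trans e₀ ?_
  rw [M.integral_indicator_comp_X x n f (h₁'.inter h₄),
    M.integral_indicator_comp_X x n g (h₂'.inter h₃),
    M.integral_indicator_comp_X x n h (h₁'.inter h₃),
    ← Finset.sum_add_distrib, ← Finset.sum_add_distrib]
  refine Finset.sum_congr rfl fun y _ => ?_
  have e₁ := M.measure_inter_lt_markovTime x hij q n y h₁
  have e₂ := M.measure_inter_markovTime_eq x hij q n y h₂
  have e₃ := M.measure_inter_markovTime_eq x hij q n y h₁
  rw [e₁, e₂, e₃]
  simp only [stopPayoff, stopping, waiting]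
  ring

theorem survival_succ (hQ : ∀ y z, 0 ≤ Q y z) {i j : Fin 2} (hij : i ≠ j) {τ : Ω → ℕ∞}
    (hτ : τ ∈ M.admissible i) (q : E → unitInterval) (x : E) (n : ℕ) (z : E) :
    M.survival x τ (M.markovTime j q) (n + 1) z =
      ∑ y, Q y z * ((1 - q y) * M.waiting x τ (M.markovTime j q) n y) := by
  have hσ := M.markovTime_mem_admissible j q
  have h₂ := measurableSet_gt_of_mem_admissible hτ n
  have h₂' := (M.filtration i).le n _ h₂
  have h₄ := (M.filtration j).le n _ (measurableSet_gt_of_mem_admissible hσ n)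
  have hlt (t : ℕ∞) : ((n + 1 : ℕ) : ℕ∞) ≤ t ↔ (n : ℕ∞) < t := by
    rw [Nat.cast_add, Nat.cast_one, ENat.add_one_le_iff (ENat.natCast_ne_top n)]
  have hX : MeasurableSet {ω | M.X (n + 1) ω = z} :=
    M.measurable_X (n + 1) (measurableSet_singleton z)
  simp only [survival, hlt]
  rw [M.measureReal_eq_sum_inter_X x n ((h₂'.inter h₄).inter hX)]
  refine Finset.sum_congr rfl fun y _ => ?_
  rw [waiting]
  refine Eq.trans ?_ (M.measure_survive_step hQ x hij q n y z h₂)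
  congr 1
  ext ω
  simp only [Set.mem_inter_iff, Set.mem_ofPred_eq]
  exact ⟨fun h => ⟨h.1.1, h.2, h.1.2⟩, fun h => ⟨⟨h.1, h.2.2⟩, h.2.1⟩⟩

/-- Mass survives to `n + 1` only if both players wait at `n`, and it then moves by `Q`; this is the
continuation term of `waitPayoff`. Since `v` is arbitrary, the identity serves both the inequality
and the equality below. -/
theorem stage_identity (hQ : ∀ y z, 0 ≤ Q y z) {i j : Fin 2} (hij : i ≠ j) {τ : Ω → ℕ∞}
    (hτ : τ ∈ M.admissible i) (q : E → unitInterval) (α : ℝ) (f g h v : E → ℝ) (x : E) (n : ℕ) :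
    ∫ ω, M.stageReward f g h τ (M.markovTime j q) n ω ∂(M.P x) +
        α * ∑ z, M.survival x τ (M.markovTime j q) (n + 1) z * v z =
      ∑ y, (M.stopping x τ (M.markovTime j q) n y * stopPayoff f h q y +
        M.waiting x τ (M.markovTime j q) n y * waitPayoff Q α g q v y) := by
  have hsum : ∑ z, M.survival x τ (M.markovTime j q) (n + 1) z * v z =
      ∑ y, M.waiting x τ (M.markovTime j q) n y * ((1 - q y) * ∑ z, Q y z * v z) := by
    simp only [M.survival_succ hQ hij hτ, Finset.sum_mul, Finset.mul_sum]
    rw [Finset.sum_comm]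
    exact Finset.sum_congr rfl fun y _ => Finset.sum_congr rfl fun z _ => by ring
  rw [hsum, M.integral_stageReward hij hτ, Finset.mul_sum, ← Finset.sum_add_distrib]
  refine Finset.sum_congr rfl fun y _ => ?_
  rw [waitPayoff]
  ring

theorem tendsto_survival {α : ℝ} (hα₀ : 0 ≤ α) (hα₁ : α < 1) (v : E → ℝ) (x : E)
    (τ σ : Ω → ℕ∞) :
    Filter.Tendsto (fun n => α ^ n * ∑ z, M.survival x τ σ n z * v z) Filter.atTop (nhds 0) := by
  have hb : Filter.Tendsto (fun n : ℕ => α ^ n * ∑ z, |v z|) Filter.atTop (nhds 0) := by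
    simpa using (tendsto_pow_atTop_nhds_zero_of_lt_one hα₀ hα₁).mul_const (∑ z, |v z|)
  refine squeeze_zero_norm (fun n => ?_) hb
  rw [norm_mul, Real.norm_of_nonneg (pow_nonneg hα₀ n)]
  refine mul_le_mul_of_nonneg_left ((norm_sum_le _ _).trans (Finset.sum_le_sum fun z _ => ?_))
    (pow_nonneg hα₀ n)
  rw [norm_mul, survival, Real.norm_of_nonneg measureReal_nonneg]
  exact mul_le_of_le_one_left (abs_nonneg _) measureReal_le_one

/-- Verification: a function that dominates both the stopping and the waiting payoff against a
Markovian strategy bounds the expected reward of all stopping times. -/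
theorem expectedReward_le (hQ : ∀ y z, 0 ≤ Q y z) {α : ℝ} (hα₀ : 0 ≤ α) (hα₁ : α < 1)
    {i j : Fin 2} (hij : i ≠ j) {τ : Ω → ℕ∞} (hτ : τ ∈ M.admissible i) (q : E → unitInterval)
    (f g h v : E → ℝ) (hnow : ∀ y, stopPayoff f h q y ≤ v y)
    (hwait : ∀ y, waitPayoff Q α g q v y ≤ v y) (x : E) :
    M.expectedReward α f g h x τ (M.markovTime j q) ≤ v x := by
  classical
  have hσ := M.markovTime_mem_admissible j q
  -- The reward before `n` plus the discounted `v` on the surviving mass equals `v x` at `n = 0`,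
  -- does not increase, and tends to the expected reward.
  have hlim := (M.hasSum_expectedReward hα₀ hα₁ hτ hσ f g h x).tendsto_sum_nat.add
    (M.tendsto_survival hα₀ hα₁ v x τ (M.markovTime j q))
  rw [add_zero] at hlim
  refine le_of_tendsto' hlim fun n => ?_
  induction n with
  | zero => simp [survival_zero]
  | succ n ih =>
    refine le_trans ?_ ih
    rw [Finset.sum_range_succ, add_assoc, add_le_add_iff_left, pow_succ, mul_assoc, ← mul_add,
      M.stage_identity hQ hij hτ]
    refine mul_le_mul_of_nonneg_left (Finset.sum_le_sum fun y _ => ?_) (pow_nonneg hα₀ n)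
    rw [← M.stopping_add_waiting hτ hσ, add_mul]
    exact add_le_add (mul_le_mul_of_nonneg_left (hnow y) measureReal_nonneg)
      (mul_le_mul_of_nonneg_left (hwait y) measureReal_nonneg)

/-- The expected reward of a pair of Markovian strategies solves a linear equation. -/
theorem expectedReward_markovTime (hQ : ∀ y z, 0 ≤ Q y z) {α : ℝ} (hα₀ : 0 ≤ α) (hα₁ : α < 1)
    {i j : Fin 2} (hij : i ≠ j) (p q : E → unitInterval) (f g h v : E → ℝ)
    (hv : ∀ y, v y = p y * stopPayoff f h q y + (1 - p y) * waitPayoff Q α g q v y) (x : E) :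
    M.expectedReward α f g h x (M.markovTime i p) (M.markovTime j q) = v x := by
  classical
  have hτ := M.markovTime_mem_admissible i p
  have hσ := M.markovTime_mem_admissible j q
  have hlim := (M.hasSum_expectedReward hα₀ hα₁ hτ hσ f g h x).tendsto_sum_nat.add
    (M.tendsto_survival hα₀ hα₁ v x (M.markovTime i p) (M.markovTime j q))
  rw [add_zero] at hlim
  refine tendsto_nhds_unique hlim (tendsto_const_nhds.congr fun n => Eq.symm ?_)
  induction n with
  | zero => simp [survival_zero]
  | succ n ih =>
    refine Eq.trans ?_ ih
    rw [Finset.sum_range_succ, add_assoc, add_right_inj, pow_succ, mul_assoc, ← mul_add,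
      M.stage_identity hQ hij hτ]
    congr 1
    refine Finset.sum_congr rfl fun y _ => ?_
    -- The player's own strategy is Markovian too, so the same independence applies with the roles
    -- exchanged and `B` the survival of `j`.
    have hs : M.stopping x (M.markovTime i p) (M.markovTime j q) n y =
        p y * M.survival x (M.markovTime i p) (M.markovTime j q) n y := by
      have e := M.measure_inter_markovTime_eq x hij.symm p n y
        (M.measurableSet_le_markovTime_filtration j q n)
      simpa only [stopping, survival, Set.inter_comm {ω | (n : ℕ∞) ≤ M.markovTime j q ω}] using e
    have hw := M.stopping_add_waiting hτ hσ x n y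
    rw [hs, eq_sub_of_add_eq' hw, hs]
    conv_rhs => rw [hv y]
    ring

end DynkinModel

/-! ### The value equations of the example -/

/-- `v` solves the linear equations for the value of the example under the strategies `p` of
player 1 and `q` of player 2. -/
def IsExampleValue (p q : Fin 2 → unitInterval) (v : Fin 2 → ℝ) : Prop :=
  v 0 = 2 * p 0 * q 0 + (1 - p 0) * (1 - q 0) * (2 / 5 * (v 0 + v 1)) ∧
  v 1 = p 1 * (5 - q 1) + (1 - p 1) * (3 * q 1 + (1 - q 1) * (4 / 5 * v 1))

/-- The system is triangular, because the equation of the absorbing state is closed. Each diagonal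
equation is solvable since its self-coefficient is at most the constant `d < 1`. -/
theorem exists_isExampleValue (p q : Fin 2 → unitInterval) : ∃ v, IsExampleValue p q v := by
  have key (a b : unitInterval) (c d : ℝ) (hd₀ : 0 ≤ d) (hd₁ : d < 1) :
      ∃ t : ℝ, t = c + (1 - a) * (1 - b) * (d * t) := by
    have h : (1 - a : ℝ) * (1 - b) ≤ 1 :=
      mul_le_one₀ (by linarith [a.2.1]) (by linarith [b.2.2]) (by linarith [b.2.1])
    have h' : 1 - (1 - a : ℝ) * (1 - b) * d ≠ 0 := by nlinarith
    refine ⟨c / (1 - (1 - a) * (1 - b) * d), ?_⟩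
    field_simp
    ring
  obtain ⟨t, ht⟩ := key (p 1) (q 1) (p 1 * (5 - q 1) + (1 - p 1) * (3 * q 1)) (4 / 5)
    (by norm_num) (by norm_num)
  obtain ⟨s, hs⟩ := key (p 0) (q 0)
    (2 * p 0 * q 0 + (1 - p 0) * (1 - q 0) * (2 / 5 * t)) (2 / 5) (by norm_num) (by norm_num)
  refine ⟨![s, t], ?_, ?_⟩
  · simp only [Matrix.cons_val_zero, Matrix.cons_val_one, Matrix.cons_val_fin_one]
    linear_combination hs
  · simp only [Matrix.cons_val_one, Matrix.cons_val_fin_one]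
    linear_combination ht

theorem exampleMatrix_nonneg (y z : Fin 2) : 0 ≤ exampleMatrix y z := by
  fin_cases y <;> fin_cases z <;> simp [exampleMatrix]

namespace DynkinModel

variable {Ω : Type*} [MeasurableSpace Ω] (M : DynkinModel (Fin 2) exampleMatrix Ω)

theorem exampleReward_player_one {p q : Fin 2 → unitInterval} {v : Fin 2 → ℝ}
    (hv : IsExampleValue p q v) (x : Fin 2) :
    M.expectedReward exampleDiscount exampleF exampleG exampleH x
      (M.markovTime 0 p) (M.markovTime 1 q) = v x := by
  refine M.expectedReward_markovTime exampleMatrix_nonneg (by norm_num [exampleDiscount])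
    (by norm_num [exampleDiscount]) (by decide) p q _ _ _ v ?_ x
  refine Fin.forall_fin_two.2 ⟨?_, ?_⟩
  · simp [stopPayoff, waitPayoff, exampleF, exampleG, exampleH, exampleMatrix, exampleDiscount]
    linear_combination hv.1
  · simp [stopPayoff, waitPayoff, exampleF, exampleG, exampleH, exampleMatrix, exampleDiscount]
    linear_combination hv.2

/-- Exchanging the players and negating the rewards turns the value equation for `v` into the one
for `-v`. -/
theorem exampleReward_player_two {p q : Fin 2 → unitInterval} {v : Fin 2 → ℝ}
    (hv : IsExampleValue p q v) (x : Fin 2) :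
    M.expectedReward exampleDiscount (-exampleG) (-exampleF) (-exampleH) x
      (M.markovTime 1 q) (M.markovTime 0 p) = - v x := by
  refine M.expectedReward_markovTime exampleMatrix_nonneg (by norm_num [exampleDiscount])
    (by norm_num [exampleDiscount]) (by decide) q p _ _ _ (-v) ?_ x
  refine Fin.forall_fin_two.2 ⟨?_, ?_⟩
  · simp [stopPayoff, waitPayoff, exampleF, exampleG, exampleH, exampleMatrix, exampleDiscount]
    linear_combination -hv.1
  · simp [stopPayoff, waitPayoff, exampleF, exampleG, exampleH, exampleMatrix, exampleDiscount]
    linear_combination -hv.2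

/-! ### Necessary conditions for an equilibrium -/

variable {M} {p q : Fin 2 → unitInterval} {v w : Fin 2 → ℝ}

theorem IsGlobalMarkovEquilibrium.le_of_deviation_one
    (he : M.IsGlobalMarkovEquilibrium exampleDiscount exampleF exampleG exampleH p q)
    (hv : IsExampleValue p q v) {p' : Fin 2 → unitInterval} (hw : IsExampleValue p' q w)
    (x : Fin 2) : w x ≤ v x := by
  rw [← M.exampleReward_player_one hv, ← M.exampleReward_player_one hw]
  exact (he x).2.2.1.1 ⟨_, M.markovTime_mem_admissible 0 p', rfl⟩

theorem IsGlobalMarkovEquilibrium.le_of_deviation_two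
    (he : M.IsGlobalMarkovEquilibrium exampleDiscount exampleF exampleG exampleH p q)
    (hv : IsExampleValue p q v) {q' : Fin 2 → unitInterval} (hw : IsExampleValue p q' w)
    (x : Fin 2) : v x ≤ w x := by
  rw [← neg_le_neg_iff, ← M.exampleReward_player_two hv, ← M.exampleReward_player_two hw]
  exact (he x).2.2.2.1 ⟨_, M.markovTime_mem_admissible 1 q', rfl⟩

/-- In the absorbing state both players stop at once. -/
theorem IsGlobalMarkovEquilibrium.stop_in_absorbing_state
    (he : M.IsGlobalMarkovEquilibrium exampleDiscount exampleF exampleG exampleH p q) :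
    (p 1 : ℝ) = 1 ∧ (q 1 : ℝ) = 1 := by
  obtain ⟨v, hv⟩ := exists_isExampleValue p q
  obtain ⟨w, hw⟩ := exists_isExampleValue ![p 0, 1] q
  obtain ⟨u, hu⟩ := exists_isExampleValue p ![q 0, 1]
  have h₁ := he.le_of_deviation_one hv hw 1
  have h₂ := he.le_of_deviation_two hv hu 1
  have hv' := hv.2
  have hw' := hw.2
  have hu' := hu.2
  simp only [Matrix.cons_val_one, Matrix.cons_val_fin_one, Set.Icc.coe_one, sub_self, zero_mul, add_zero,
    one_mul, mul_one] at hw' hu'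
  have hp := (p 1).2
  have hq := (q 1).2
  generalize (p 1 : ℝ) = a at *
  generalize (q 1 : ℝ) = b at *
  -- Deviating to a sure stop gives `5 - b ≤ v 1 ≤ 3 + a`.
  have hb : 0 ≤ 1 - b := by linarith [hq.2]
  have hv4 : 4 ≤ v 1 := by linarith
  have ha : a = 1 := by
    by_contra hne
    have hlt : 0 < 1 - a := by
      have := lt_of_le_of_ne hp.2 hne
      linarith
    -- `v 1` averages the stopping and the waiting payoff, and the former is at most `v 1`. As
    -- waiting has positive weight, its payoff is at least `v 1`, which is impossible when `v 1 ≥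
    -- 4`.
    have hwait : v 1 ≤ 3 * b + (1 - b) * (4 / 5 * v 1) := by
      by_contra! hc
      nlinarith [mul_pos hlt (sub_pos.2 hc), mul_nonneg hp.1 (sub_nonneg.2 h₁)]
    nlinarith [mul_nonneg hq.1 (sub_nonneg.2 hv4), hq.1]
  subst ha
  exact ⟨rfl, by linarith⟩

theorem IsGlobalMarkovEquilibrium.mix_in_transient_state
    (he : M.IsGlobalMarkovEquilibrium exampleDiscount exampleF exampleG exampleH p q) :
    (p 0 : ℝ) = 1 / 2 ∧ (q 0 : ℝ) = 1 / 2 := by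
  obtain ⟨hp₁, hq₁⟩ := he.stop_in_absorbing_state
  obtain ⟨v, hv⟩ := exists_isExampleValue p q
  obtain ⟨w₁, hw₁⟩ := exists_isExampleValue ![1, p 1] q
  obtain ⟨w₀, hw₀⟩ := exists_isExampleValue ![0, p 1] q
  obtain ⟨u₁, hu₁⟩ := exists_isExampleValue p ![1, q 1]
  obtain ⟨u₀, hu₀⟩ := exists_isExampleValue p ![0, q 1]
  have h₁ := he.le_of_deviation_one hv hw₁ 0
  have h₂ := he.le_of_deviation_one hv hw₀ 0
  have h₃ := he.le_of_deviation_two hv hu₁ 0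
  have h₄ := he.le_of_deviation_two hv hu₀ 0
  obtain ⟨a₁, -⟩ := hw₁
  obtain ⟨a₂, b₂⟩ := hw₀
  obtain ⟨a₃, -⟩ := hu₁
  obtain ⟨a₄, b₄⟩ := hu₀
  simp only [Matrix.cons_val_one, Matrix.cons_val_fin_one, Matrix.cons_val_zero, hp₁, hq₁, Set.Icc.coe_one,
    Set.Icc.coe_zero] at a₁ a₂ a₃ a₄ b₂ b₄
  have hb₂ : w₀ 1 = 4 := by linarith
  have hb₄ : u₀ 1 = 4 := by linarith
  rw [hb₂] at a₂
  rw [hb₄] at a₄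
  have hp := (p 0).2
  have hq := (q 0).2
  generalize (p 0 : ℝ) = s at *
  generalize (q 0 : ℝ) = t at *
  have hv₂ : v 0 ≤ 2 * s := by linarith
  have hv₁ : 2 * t ≤ v 0 := by linarith
  -- If `s > 1 / 2`, player 2 holds `v 0` below 1 by waiting. Then `2 * t ≤ v 0` forces `t < 1 / 2`,
  -- and player 1 gets more than 1 by waiting, a contradiction.
  have hs : s ≤ 1 / 2 := by
    by_contra! hc
    have : v 0 < 1 := by nlinarith [hp.2]
    have ht : t < 1 / 2 := by linarith
    nlinarith [hq.1]
  -- Otherwise waiting yields player 1 more than 1, while `v 0 ≤ 2 * s ≤ 1`.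
  have ht : 1 / 2 ≤ t := by
    by_contra! hc
    nlinarith [hq.1]
  exact ⟨by linarith, by linarith⟩

end DynkinModel

/-! ### The mixed pair is an equilibrium -/

theorem isExampleValue_of_mixed {p q : Fin 2 → unitInterval} (hp₀ : (p 0 : ℝ) = 1 / 2)
    (hq₀ : (q 0 : ℝ) = 1 / 2) (hp₁ : (p 1 : ℝ) = 1) (hq₁ : (q 1 : ℝ) = 1) :
    IsExampleValue p q ![1, 4] := by
  refine ⟨?_, ?_⟩ <;> norm_num [hp₀, hq₀, hp₁, hq₁]

theorem DynkinModel.isGlobalMarkovEquilibrium_of_mixed {Ω : Type*} [MeasurableSpace Ω]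
    (M : DynkinModel (Fin 2) exampleMatrix Ω) {p q : Fin 2 → unitInterval}
    (hp₀ : (p 0 : ℝ) = 1 / 2) (hq₀ : (q 0 : ℝ) = 1 / 2) (hp₁ : (p 1 : ℝ) = 1)
    (hq₁ : (q 1 : ℝ) = 1) :
    M.IsGlobalMarkovEquilibrium exampleDiscount exampleF exampleG exampleH p q := by
  have hv := isExampleValue_of_mixed hp₀ hq₀ hp₁ hq₁
  have hp := M.markovTime_mem_admissible 0 p
  have hq := M.markovTime_mem_admissible 1 q
  refine fun x => ⟨hp, hq, IsGreatest.isLUB ⟨⟨_, hp, rfl⟩, ?_⟩, IsGreatest.isLUB ⟨⟨_, hq, rfl⟩, ?_⟩⟩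
  · rintro _ ⟨τ, hτ, rfl⟩
    rw [M.exampleReward_player_one hv]
    -- In the transient state stopping and waiting both give exactly 1; in the absorbing state they
    -- give 4 and 3.
    refine M.expectedReward_le exampleMatrix_nonneg (by norm_num [exampleDiscount])
      (by norm_num [exampleDiscount]) (by decide) hτ q _ _ _ _ ?_ ?_ x
    all_goals
      refine Fin.forall_fin_two.2 ⟨?_, ?_⟩ <;>
      norm_num [stopPayoff, waitPayoff, exampleF, exampleG, exampleH, exampleMatrix,
        exampleDiscount, hq₀, hq₁]
  · rintro _ ⟨τ, hτ, rfl⟩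
    rw [M.exampleReward_player_two hv]
    -- For player 2 both choices give -1 in the transient state; in the absorbing state stopping
    -- gives -4 and waiting -5.
    refine M.expectedReward_le exampleMatrix_nonneg (by norm_num [exampleDiscount])
      (by norm_num [exampleDiscount]) (by decide) hτ p _ _ _ (-![1, 4]) ?_ ?_ x
    all_goals
      refine Fin.forall_fin_two.2 ⟨?_, ?_⟩ <;>
      norm_num [stopPayoff, waitPayoff, exampleF, exampleG, exampleH, exampleMatrix,
        exampleDiscount, hp₀, hp₁]

theorem mainTheorem5 {Ω : Type*} [MeasurableSpace Ω]
    (M : DynkinModel (Fin 2) exampleMatrix Ω) :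
    (¬ ∃ p₁ p₂ : Fin 2 → unitInterval,
      M.IsGlobalMarkovEquilibrium exampleDiscount exampleF exampleG exampleH p₁ p₂ ∧
        IsPureStrategy p₁ ∧ IsPureStrategy p₂) ∧
    (∀ p₁ p₂ : Fin 2 → unitInterval,
      M.IsGlobalMarkovEquilibrium exampleDiscount exampleF exampleG exampleH p₁ p₂ ↔
        ((p₁ 0 : ℝ) = 1 / 2 ∧ (p₂ 0 : ℝ) = 1 / 2 ∧ (p₁ 1 : ℝ) = 1 ∧ (p₂ 1 : ℝ) = 1)) ∧
    (∀ p₁ p₂ : Fin 2 → unitInterval,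
      M.IsGlobalMarkovEquilibrium exampleDiscount exampleF exampleG exampleH p₁ p₂ →
        M.value exampleDiscount exampleF exampleG exampleH p₁ p₂ 0 = 1 ∧
        M.value exampleDiscount exampleF exampleG exampleH p₁ p₂ 1 = 4) := by
  refine ⟨?_, fun p₁ p₂ => ⟨fun he => ?_, fun h => ?_⟩, fun p₁ p₂ he => ?_⟩
  · rintro ⟨p₁, p₂, he, hp, -⟩
    have h := he.mix_in_transient_state.1
    rcases hp 0 with h₀ | h₀ <;> norm_num [h₀] at h
  · exact ⟨he.mix_in_transient_state.1, he.mix_in_transient_state.2,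
      he.stop_in_absorbing_state.1, he.stop_in_absorbing_state.2⟩
  · exact M.isGlobalMarkovEquilibrium_of_mixed h.1 h.2.1 h.2.2.1 h.2.2.2
  · have hv := isExampleValue_of_mixed he.mix_in_transient_state.1 he.mix_in_transient_state.2
      he.stop_in_absorbing_state.1 he.stop_in_absorbing_state.2
    exact ⟨M.exampleReward_player_one hv 0, M.exampleReward_player_one hv 1⟩
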